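/- Let $q>4$ be a prime power and let $n\ge 1$. For $c\in\mathbb{F}_q^{2n}$ let $\mathrm{wt}(c)$ be the number of non-zero coordinates of $c$. Let $\mathcal{C}\subseteq\mathbb{F}_q^{2n}$ be a linear code (a linear subspace) with weight enumerator $$w_{\mathcal C}(x,y)=\sum_{c\in\mathcal C}x^{2n-\mathrm{wt}(c)}y^{\mathrm{wt}(c)}\in\mathbb{C}[x,y].$$ Suppose that $\mathcal C$ is formally self-dual, i.e. $$w_{\mathcal C}\!\left(\frac{x+(q-1)y}{\sqrt q},\frac{x-y}{\sqrt q}\right)=w_{\mathcal C}(x,y),$$ and divisible, i.e. there is an integer $m>1$ that divides $\mathrm{wt}(c)$ for every $c\in\mathcal C$. Then $\mathcal C$ is equivalent to the direct sum $$\bigoplus_{i=1}^{n}\langle(1,1)\rangle_{\mathbb{F}_q}=\{(a_1,a_1,a_2,a_2,\dots,a_n,a_n) : a_1,\dots,a_n\in\mathbb{F}_q\}$$ of $n$ copies of $\langle(1,1)\rangle_{\mathbb{F}_q}$; that is, the latter is the image of $\mathcal C$ under a monomial transformation $v\mapsto DPv$ of $\mathbb{F}_q^{2n}$, where $D$ is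 an invertible diagonal matrix and $P$ is a permutation matrix. -/

import Mathlib

open MvPolynomial

noncomputable section

namespace LinearCodes

/-- A linear code of length `N` over `F`: a linear subspace of `F ^ N`. -/
abbrev Code (F : Type*) [Field F] (N : ℕ) := Submodule F (Fin N → F)

section Weights

variable {F : Type*} [Field F] [DecidableEq F] {N : ℕ}

open Classical in
/-- The weight enumerator `∑_{c ∈ C} x ^ (N - wt c) * y ^ (wt c)`, with complex coefficients;
the variables are `x = X 0` and `y = X 1`. -/
def weightEnumerator [Fintype F] (C : Code F N) : MvPolynomial (Fin 2) ℂ :=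
  ∑ c : Fin N → F with c ∈ C, X 0 ^ (N - hammingNorm c) * X 1 ^ hammingNorm c

/-- All weights of codewords are divisible by `m`. -/
def IsDivisibleBy (C : Code F N) (m : ℕ) : Prop :=
  ∀ c ∈ C, m ∣ hammingNorm c

/-- The code is divisible by some `m > 1`. -/
def IsDivisible (C : Code F N) : Prop :=
  ∃ m : ℕ, 1 < m ∧ IsDivisibleBy C m

end Weights

/-- The right action of `GL₂(ℂ)` on `ℂ[x, y]`: for `g` with rows `(a, b)` and `(c, d)` this is
`p (a x + b y, c x + d y)`. -/
def act (p : MvPolynomial (Fin 2) ℂ) (g : GL (Fin 2) ℂ) : MvPolynomial (Fin 2) ℂ :=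
  aeval (fun i => ∑ j, C (g.val i j) * X j) p

/-- The symmetries of `p`: its stabilizer in `GL₂(ℂ)`. -/
def symmetries (p : MvPolynomial (Fin 2) ℂ) : Set (GL (Fin 2) ℂ) :=
  {g | act p g = p}

/-- The matrix `q ^ (-1/2) * [1, q - 1; 1, -1]`. -/
def macWilliamsMatrix (q : ℕ) : Matrix (Fin 2) (Fin 2) ℂ :=
  ((Real.sqrt q : ℝ) : ℂ)⁻¹ • !![1, (q : ℂ) - 1; 1, -1]

theorem det_macWilliamsMatrix_ne_zero {q : ℕ} (hq : q ≠ 0) :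
    (macWilliamsMatrix q).det ≠ 0 := by
  have h : ((Real.sqrt q : ℝ) : ℂ) ≠ 0 := by
    rw [Complex.ofReal_ne_zero]
    positivity
  have h' : (q : ℂ) ≠ 0 := by exact_mod_cast hq
  rw [macWilliamsMatrix, Matrix.det_smul, Matrix.det_fin_two_of]
  refine mul_ne_zero (pow_ne_zero _ (inv_ne_zero h)) ?_
  intro h0
  apply h'
  linear_combination -h0

/-- `macWilliamsMatrix q` as an element of `GL₂(ℂ)`. -/
def macWilliamsGL (q : ℕ) (hq : q ≠ 0) : GL (Fin 2) ℂ :=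
  Matrix.GeneralLinearGroup.mkOfDetNeZero (macWilliamsMatrix q) (det_macWilliamsMatrix_ne_zero hq)

/-- A code over `𝔽_q` is formally self-dual if `q ^ (-1/2) * [1, q - 1; 1, -1]` is a symmetry of
its weight enumerator. -/
def IsFormallySelfDual {F : Type*} [Field F] [DecidableEq F] [Fintype F] {N : ℕ}
    (C : Code F N) : Prop :=
  macWilliamsGL (Fintype.card F) Fintype.card_ne_zero ∈ symmetries (weightEnumerator C)

section Equivalence

variable {F : Type*} [Field F]

/-- The monomial transformation `v ↦ D P v`, where `D` is the diagonal matrix with non-zero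
entries `d` and `P` is the permutation matrix of `σ`. -/
def monomialMap {N : ℕ} (d : Fin N → Fˣ) (σ : Equiv.Perm (Fin N)) :
    (Fin N → F) →ₗ[F] (Fin N → F) :=
  Matrix.mulVecLin (Matrix.diagonal (fun i => (d i : F)) * σ.permMatrix F)

/-- Two codes are equivalent if one is the image of the other under a monomial transformation. -/
def IsEquivalent {N : ℕ} (C D : Code F N) : Prop :=
  ∃ (d : Fin N → Fˣ) (σ : Equiv.Perm (Fin N)), D = Submodule.map (monomialMap d σ) C

/-- The positions `k * i, …, k * i + k - 1` of the `i`-th block of length `k`. -/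
def block (k n : ℕ) (i : Fin n) (j : Fin k) : Fin (k * n) :=
  ⟨k * i + j, calc
    k * (i : ℕ) + j < k * i + k := Nat.add_lt_add_left j.isLt _
    _ = k * (i + 1) := (Nat.mul_succ _ _).symm
    _ ≤ k * n := Nat.mul_le_mul_left _ i.isLt⟩

/-- The direct sum of `n` copies of `C`, embedded blockwise in `F ^ (k * n)`: the vectors each of
whose `n` consecutive blocks of length `k` is a codeword of `C`. -/
def directSumCopies {k : ℕ} (C : Code F k) (n : ℕ) : Code F (k * n) :=
  ⨅ i : Fin n, Submodule.comap (LinearMap.funLeft F F (block k n i)) C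

variable (F) in
/-- The code of length two spanned by `(1, 1)`. -/
def repetitionTwo : Code F 2 :=
  Submodule.span F {![1, 1]}

end Equivalence

end LinearCodes

end

/-! ### Roots of unity and iteration of a 2 × 2 matrix -/

section

open Polynomial

/-! For `ζ ^ m = 1`, the zeros of the weight enumerator in the projective line form a finite set
mapped into itself by `(x, y) ↦ (x + (q - 1) ζ y, x - ζ y)`. If `ζ ≠ 1`, the eigenvalue ratio of
this map is not a root of unity (`eq_one_of_rootsOfUnity_relation`, where `q > 4` enters), so a
zero, having a finite orbit, must be a fixed point. Comparing the fixed-point equations for a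
primitive `ζ` and for `ζ⁻¹` gives `m = 2` and `x² = -(q - 1)`; the enumerator is therefore `(x² + (q
- 1) y²) ^ n` (`weightPolynomial_eq`).

Hence the code has dimension `n` and `n (q - 1)` words of weight two. Evenness makes the two
coordinates in the support of such a word proportional throughout the code, so each position meets
at most `q - 1` of these words. Double counting shows that every position meets one. The positions
thus fall into `n` proportional pairs, and the dimension leaves no further relation
(`isEquivalent_directSumCopies_of_pairing`). -/

/-- For `q > 4` and roots of unity `ζ ≠ 1` and `η`, the quotient `(2 - ζ - ζ⁻¹) / q` is not
`2 + η + η⁻¹`: it would be a non-zero algebraic integer all of whose conjugates lie in the open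
unit disc. -/
theorem eq_one_of_rootsOfUnity_relation {q : ℕ} (hq : 4 < q) {ζ η : ℂ} {m k : ℕ} (hm : 0 < m)
    (hk : 0 < k) (hζ : ζ ^ m = 1) (hη : η ^ k = 1)
    (h : (q : ℂ) * (2 + η + η⁻¹) = 2 - ζ - ζ⁻¹) : ζ = 1 := by
  have hζi : IsIntegral ℤ ζ := ⟨Polynomial.X ^ m - 1, monic_X_pow_sub_C 1 hm.ne', by simp [hζ]⟩
  have hηi : IsIntegral ℤ η := ⟨Polynomial.X ^ k - 1, monic_X_pow_sub_C 1 hk.ne', by simp [hη]⟩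
  have hηi' : IsIntegral ℤ η⁻¹ :=
    ⟨Polynomial.X ^ k - 1, monic_X_pow_sub_C 1 hk.ne', by simp [hη]⟩
  let K : IntermediateField ℚ ℂ := IntermediateField.adjoin ℚ {ζ, η}
  have : FiniteDimensional ℚ K := by
    apply IntermediateField.finiteDimensional_adjoin
    rintro x (rfl | rfl)
    · exact hζi.tower_top
    · exact hηi.tower_top
  let z : K := ⟨ζ, IntermediateField.subset_adjoin ℚ _ (by simp)⟩
  let e : K := ⟨η, IntermediateField.subset_adjoin ℚ _ (by simp)⟩
  have hz : z ^ m = 1 := Subtype.ext (by simpa [z] using hζ)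
  have hze : (q : K) * (1 + 1 + e + e⁻¹) = 1 + 1 - z - z⁻¹ :=
    (algebraMap K ℂ).injective (by
      simp only [map_mul, map_add, map_sub, map_inv₀, map_natCast, one_add_one_eq_two]
      exact h)
  set b : K := 1 + 1 + e + e⁻¹ with hb
  have hbi : IsIntegral ℤ b := by
    have h1 : IsIntegral ℤ ((algebraMap K ℂ) b) := by
      have : (algebraMap K ℂ) b = 2 + η + η⁻¹ := by
        simp only [hb, map_add, map_inv₀, one_add_one_eq_two]
        rfl
      rw [this]
      exact ((isIntegral_algebraMap (R := ℤ) (x := (2 : ℤ))).add hηi).add hηi'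
    exact (isIntegral_algebraMap_iff (algebraMap K ℂ).injective).1 h1
  have hnorm := Algebra.isIntegral_norm ℚ hbi
  obtain ⟨N, hN⟩ := IsIntegrallyClosed.isIntegral_iff.1 hnorm
  have hprod := Algebra.norm_eq_prod_embeddings ℚ ℂ b
  have hlt : ∀ σ : K →ₐ[ℚ] ℂ, ‖σ b‖ < 1 := by
    intro σ
    have h1 : ‖σ z‖ = 1 := Complex.norm_eq_one_of_pow_eq_one (by rw [← map_pow, hz, map_one]) hm.ne'
    have h2 : (q : ℂ) * σ b = 2 - σ z - (σ z)⁻¹ := by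
      have := congrArg σ hze
      simp only [map_mul, map_add, map_sub, map_inv₀, map_natCast, map_one] at this
      rw [this, one_add_one_eq_two]
    have h3 : (q : ℝ) * ‖σ b‖ ≤ 4 := by
      have : ‖(q : ℂ) * σ b‖ ≤ ‖(2 : ℂ)‖ + ‖σ z‖ + ‖(σ z)⁻¹‖ := by
        rw [h2]
        exact (norm_sub_le _ _).trans (by gcongr; exact norm_sub_le _ _)
      rw [norm_mul, norm_inv, h1] at this
      norm_num at this
      exact this
    have h4 : (4 : ℝ) < q := by exact_mod_cast hq
    by_contra! h5
    nlinarith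
  have hN1 : ‖((N : ℤ) : ℂ)‖ < 1 := by
    have : ((N : ℤ) : ℂ) = ∏ σ : K →ₐ[ℚ] ℂ, σ b := by
      rw [← hprod, ← hN]; simp
    rw [this, norm_prod]
    calc ∏ σ : K →ₐ[ℚ] ℂ, ‖σ b‖ < ∏ σ : K →ₐ[ℚ] ℂ, 1 := by
          -- The strict product inequality needs positive factors, so a vanishing factor is treated
          -- apart.
          by_cases hz : ∃ σ : K →ₐ[ℚ] ℂ, ‖σ b‖ = 0
          · obtain ⟨σ, hσ⟩ := hz
            rw [Finset.prod_eq_zero (Finset.mem_univ σ) hσ]; simp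
          · push Not at hz
            exact Finset.prod_lt_prod_of_nonempty
              (fun σ _ => lt_of_le_of_ne (norm_nonneg _) (hz σ).symm)
              (fun σ _ => hlt σ) ⟨K.val, Finset.mem_univ _⟩
      _ = 1 := by simp
  have hN0 : N = 0 := by
    rw [Complex.norm_intCast] at hN1
    have : |N| < 1 := by exact_mod_cast hN1
    exact Int.abs_lt_one_iff.1 this
  have hb0 : b = 0 := by
    rw [← Algebra.norm_eq_zero_iff (R := ℚ), ← hN, hN0]; simp
  have hβ : (2 : ℂ) + η + η⁻¹ = 0 := by
    have := congrArg (algebraMap K ℂ) hb0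
    simp only [hb, map_add, map_inv₀, map_one, map_zero] at this
    rw [one_add_one_eq_two] at this
    exact this
  rw [hβ, mul_zero] at h
  have hζ0 : ζ ≠ 0 := by rintro rfl; simp [hm.ne'] at hζ
  have : (ζ - 1) ^ 2 = 0 := by
    field_simp at h
    linear_combination h
  exact sub_eq_zero.1 (pow_eq_zero_iff two_ne_zero |>.1 this)

/-- Both `u (k + 1) - b * u k` and `u (k + 1) - a * u k` are geometric, with ratios `a` and `b`;
their difference is the left side. -/
theorem closed_form_of_recurrence {R : Type*} [CommRing R] {u : ℕ → R} {a b : R}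
    (h : ∀ k, u (k + 2) = (a + b) * u (k + 1) - a * b * u k) (k : ℕ) :
    (a - b) * u k = a ^ k * (u 1 - b * u 0) - b ^ k * (u 1 - a * u 0) := by
  induction k using Nat.twoStepInduction with
  | zero => ring
  | one => ring
  | more k h1 h2 => rw [h k]; linear_combination (a + b) * h2 - a * b * h1

/-- If two iterates of a vector under `(x, y) ↦ (x + (q - 1) ζ y, x - ζ y)` are parallel, the vector
is an eigenvector. -/
theorem isEigenvector_of_iterate_parallel {q : ℕ} (hq : 4 < q) {ζ : ℂ} {m : ℕ} (hm : 0 < m)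
    (hζ : ζ ^ m = 1) (hζ1 : ζ ≠ 1) (u v : ℕ → ℂ)
    (hu : ∀ k, u (k + 1) = u k + (q - 1) * ζ * v k) (hv : ∀ k, v (k + 1) = u k - ζ * v k)
    {i j : ℕ} (hij : i < j) (hpar : u i * v j = u j * v i) :
    u 1 * v 0 = u 0 * v 1 := by
  have hζ0 : ζ ≠ 0 := by rintro rfl; simp [hm.ne'] at hζ
  have hq0 : (q : ℂ) ≠ 0 := by exact_mod_cast (by omega : q ≠ 0)
  obtain ⟨r, hr⟩ := IsAlgClosed.exists_pow_nat_eq ((1 - ζ) ^ 2 + 4 * q * ζ) (n := 2) two_pos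
  -- The eigenvalues of the matrix with rows `(1, (q - 1) ζ)` and `(1, -ζ)`, from its trace and
  -- determinant.
  obtain ⟨lam, mu, hs, hp⟩ : ∃ lam mu : ℂ, lam + mu = 1 - ζ ∧ lam * mu = -(q * ζ) :=
    ⟨(1 - ζ + r) / 2, (1 - ζ - r) / 2, by ring, by linear_combination (-1 / 4) * hr⟩
  have hl0 : lam ≠ 0 := by
    rintro rfl; rw [zero_mul, eq_comm, neg_eq_zero] at hp; simp [hq0, hζ0] at hp
  have hm0 : mu ≠ 0 := by
    rintro rfl; rw [mul_zero, eq_comm, neg_eq_zero] at hp; simp [hq0, hζ0] at hp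
  have hroot : ∀ k : ℕ, 0 < k → lam ^ k ≠ mu ^ k := by
    intro k hk hkk
    refine hζ1 (eq_one_of_rootsOfUnity_relation hq hm hk hζ (η := lam / mu)
      (by rw [div_pow, hkk, div_self (pow_ne_zero _ hm0)]) ?_)
    field_simp
    linear_combination (q * ζ) * (lam + mu + (1 - ζ)) * hs - (2 * ζ - ζ ^ 2 - 1) * hp
  have hne : lam ≠ mu := by simpa using hroot 1 one_pos
  have hdet : lam ^ i * mu ^ j - mu ^ i * lam ^ j ≠ 0 := by
    obtain ⟨k, rfl⟩ := Nat.exists_eq_add_of_lt hij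
    have : lam ^ i * mu ^ (i + k + 1) - mu ^ i * lam ^ (i + k + 1) =
        lam ^ i * mu ^ i * (mu ^ (k + 1) - lam ^ (k + 1)) := by ring
    rw [this]
    exact mul_ne_zero (mul_ne_zero (pow_ne_zero _ hl0) (pow_ne_zero _ hm0))
      (sub_ne_zero.2 (hroot _ k.succ_pos).symm)
  have hcu := closed_form_of_recurrence (u := u) (a := lam) (b := mu) fun k => by
    rw [hu (k + 1), hv k, hs, hp, hu k]; ring
  have hcv := closed_form_of_recurrence (u := v) (a := lam) (b := mu) fun k => by
    rw [hv (k + 1), hu k, hs, hp, hv k]; ring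
  -- By the closed forms, the cross product of iterates `i` and `j` is a multiple of that of
  -- iterates `0` and `1`.
  have hmain : (lam - mu) * ((lam ^ i * mu ^ j - mu ^ i * lam ^ j) * (u 1 * v 0 - u 0 * v 1)) =
      0 := by
    have h1 : ((lam - mu) * u i) * ((lam - mu) * v j) = ((lam - mu) * u j) * ((lam - mu) * v i) := by
      linear_combination (lam - mu) ^ 2 * hpar
    rw [hcu i, hcu j, hcv i, hcv j] at h1
    linear_combination h1
  exact sub_eq_zero.1 ((mul_eq_zero.1 ((mul_eq_zero.1 hmain).resolve_left
    (sub_ne_zero.2 hne))).resolve_left hdet)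

/-! ### The weight enumerator as a function and as a polynomial -/

namespace LinearCodes

theorem hammingNorm_le {F : Type*} [Field F] [DecidableEq F] {N : ℕ} (c : Fin N → F) :
    hammingNorm c ≤ N := by
  simpa using hammingNorm_le_card_fintype (x := c)

section

variable {F : Type*} [Field F] [Fintype F] [DecidableEq F] {N : ℕ}

open Classical in
/-- The weight enumerator as a function of two complex numbers. -/
noncomputable def weightFunction (C : Code F N) (x y : ℂ) : ℂ :=
  ∑ c : Fin N → F with c ∈ C, x ^ (N - hammingNorm c) * y ^ hammingNorm c

open Classical in
/-- The weight enumerator dehomogenized at `y = 1`. -/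
noncomputable def weightPolynomial (C : Code F N) : ℂ[X] :=
  ∑ c : Fin N → F with c ∈ C, Polynomial.X ^ (N - hammingNorm c)

theorem eval_weightEnumerator (C : Code F N) (v : Fin 2 → ℂ) :
    MvPolynomial.eval v (weightEnumerator C) = weightFunction C (v 0) (v 1) := by
  simp [weightEnumerator, weightFunction]

theorem eval_weightPolynomial (C : Code F N) (x : ℂ) :
    (weightPolynomial C).eval x = weightFunction C x 1 := by
  simp [weightPolynomial, weightFunction, eval_finsetSum]

theorem weightFunction_mul (C : Code F N) (a x y : ℂ) :
    weightFunction C (a * x) (a * y) = a ^ N * weightFunction C x y := by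
  rw [weightFunction, weightFunction, Finset.mul_sum]
  refine Finset.sum_congr rfl fun c _ => ?_
  have h : a ^ N = a ^ (N - hammingNorm c) * a ^ hammingNorm c := by
    rw [← pow_add, Nat.sub_add_cancel (hammingNorm_le c)]
  rw [h]
  ring

theorem weightFunction_zero_right (C : Code F N) (x : ℂ) : weightFunction C x 0 = x ^ N := by
  rw [weightFunction, Finset.sum_eq_single 0]
  · simp
  · intro c _ hc
    rw [zero_pow (hammingNorm_ne_zero_iff.2 hc), mul_zero]
  · simp

theorem weightFunction_mul_right {C : Code F N} {m : ℕ} (hC : IsDivisibleBy C m) {ζ : ℂ}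
    (hζ : ζ ^ m = 1) (x y : ℂ) : weightFunction C x (ζ * y) = weightFunction C x y := by
  rw [weightFunction, weightFunction]
  refine Finset.sum_congr rfl fun c hc => ?_
  obtain ⟨k, hk⟩ := hC c (by simpa using hc)
  rw [mul_pow, hk, pow_mul, hζ, one_pow, one_mul]

theorem weightFunction_macWilliams {C : Code F N} (hC : IsFormallySelfDual C) (x y : ℂ) :
    weightFunction C (x + (Fintype.card F - 1) * y) (x - y) =
      ((Real.sqrt (Fintype.card F) : ℝ) : ℂ) ^ N * weightFunction C x y := by
  have hs : ((Real.sqrt (Fintype.card F) : ℝ) : ℂ) ≠ 0 := by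
    rw [Complex.ofReal_ne_zero]
    have : 0 < Fintype.card F := Fintype.card_pos
    positivity
  have h := congrArg (MvPolynomial.eval ![x, y])
    (show act (weightEnumerator C) _ = weightEnumerator C from hC)
  have hcomp : ∀ p : MvPolynomial (Fin 2) ℂ, ∀ f : Fin 2 → MvPolynomial (Fin 2) ℂ,
      MvPolynomial.eval ![x, y] (MvPolynomial.aeval f p) =
        MvPolynomial.eval (fun i => MvPolynomial.eval ![x, y] (f i)) p := by
    intro p f
    induction p using MvPolynomial.induction_on with
    | C a => simp
    | add p q hp hq => simp only [map_add, hp, hq]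
    | mul_X p i hp => simp only [map_mul, hp, MvPolynomial.aeval_X, MvPolynomial.eval_X]
  rw [act, hcomp, eval_weightEnumerator, eval_weightEnumerator] at h
  have hval : (macWilliamsGL (Fintype.card F) Fintype.card_ne_zero).val =
    macWilliamsMatrix (Fintype.card F) := rfl
  simp only [hval, macWilliamsMatrix, Fin.sum_univ_two, map_add, map_mul, MvPolynomial.eval_C,
    MvPolynomial.eval_X, Matrix.smul_apply, Matrix.of_apply, Matrix.cons_val_zero,
    Matrix.cons_val_one, smul_eq_mul, mul_one] at h
  rw [← h, ← weightFunction_mul]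
  congr 1 <;> field_simp
  ring

theorem weightFunction_eq_zero_of_macWilliams {C : Code F N} (hC : IsFormallySelfDual C)
    {m : ℕ} (hm : IsDivisibleBy C m) {ζ : ℂ}
    (hζ : ζ ^ m = 1) {x y : ℂ} (h : weightFunction C x y = 0) :
    weightFunction C (x + (Fintype.card F - 1) * ζ * y) (x - ζ * y) = 0 := by
  rw [mul_assoc, weightFunction_macWilliams hC, weightFunction_mul_right hm hζ, h, mul_zero]

open Classical in
theorem weightPolynomial_coeff (C : Code F N) (k : ℕ) (hk : k ≤ N) :
    (weightPolynomial C).coeff (N - k) =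
      (Finset.univ.filter fun c : Fin N → F => c ∈ C ∧ hammingNorm c = k).card := by
  simp only [weightPolynomial, finsetSum_coeff, Polynomial.coeff_X_pow, Finset.sum_boole,
    Finset.filter_filter]
  congr 2
  ext c
  have := hammingNorm_le c
  simp only [Finset.mem_filter, Finset.mem_univ, true_and, and_congr_right_iff]
  omega

theorem coeff_weightPolynomial_length (C : Code F N) : (weightPolynomial C).coeff N = 1 := by
  classical
  have h := weightPolynomial_coeff C 0 (Nat.zero_le N)
  have h0 : (Finset.univ.filter fun c : Fin N → F => c ∈ C ∧ hammingNorm c = 0) = {0} := by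
    ext c
    simp only [hammingNorm_eq_zero, Finset.mem_filter, Finset.mem_univ, true_and,
      Finset.mem_singleton, and_iff_right_iff_imp]
    rintro rfl
    exact C.zero_mem
  rw [Nat.sub_zero] at h
  rw [h]
  norm_cast
  convert! Finset.card_singleton (0 : Fin N → F)

theorem natDegree_weightPolynomial (C : Code F N) : (weightPolynomial C).natDegree = N := by
  refine natDegree_eq_of_le_of_coeff_ne_zero ?_ (by simp [coeff_weightPolynomial_length])
  exact natDegree_sum_le_of_forall_le _ _ fun c _ => by simp

theorem weightPolynomial_monic (C : Code F N) : (weightPolynomial C).Monic := by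
  rw [Monic, leadingCoeff, natDegree_weightPolynomial, coeff_weightPolynomial_length]

theorem weightFunction_eq_zero_iff (C : Code F N) {x y : ℂ} (hy : y ≠ 0) :
   weightFunction C x y = 0 ↔ (weightPolynomial C).IsRoot (x / y) := by
  have : weightFunction C x y = y ^ N * weightFunction C (x / y) 1 := by
    rw [← weightFunction_mul, mul_div_cancel₀ _ hy, mul_one]
  rw [this, IsRoot.def, eval_weightPolynomial]
  simp [hy]

end

end LinearCodes

/-- All roots are `±r` with `r ^ 2 = a`, and the vanishing root sum forces equal multiplicities. -/
theorem eq_X_sq_sub_C_pow_of_roots {f : ℂ[X]} (hf : f.Monic) {n : ℕ} (hn : 0 < n)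
    (hdeg : f.natDegree = 2 * n) (hcoeff : f.coeff (2 * n - 1) = 0) {a : ℂ} (ha : a ≠ 0)
    (hroots : ∀ x, f.IsRoot x → x ^ 2 = a) : f = (Polynomial.X ^ 2 - Polynomial.C a) ^ n := by
  obtain ⟨r, rfl⟩ := IsAlgClosed.exists_pow_nat_eq a (n := 2) two_pos
  have hr : r ≠ 0 := by rintro rfl; simp at ha
  have hs : f.Splits := IsAlgClosed.splits f
  have hcard : f.roots.card = 2 * n := by rw [← hdeg, hs.natDegree_eq_card_roots]
  have hsum : f.roots.sum = 0 := by
    have := hs.nextCoeff_eq_neg_sum_roots_of_monic hf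
    rw [nextCoeff_of_natDegree_pos (by omega), hdeg, hcoeff] at this
    linear_combination this
  have hsplit : f.roots = Multiset.replicate (f.roots.filter (· = r)).card r +
      Multiset.replicate (f.roots.filter (¬ · = r)).card (-r) := by
    conv_lhs => rw [← Multiset.filter_add_not (· = r) f.roots]
    congr 1
    · exact Multiset.eq_replicate_card.2 fun x hx => (Multiset.mem_filter.1 hx).2
    · refine Multiset.eq_replicate_card.2 fun x hx => ?_
      obtain ⟨hx, hne⟩ := Multiset.mem_filter.1 hx
      exact (sq_eq_sq_iff_eq_or_eq_neg.1 (hroots x (isRoot_of_mem_roots hx))).resolve_left hne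
  generalize (f.roots.filter (· = r)).card = k at hsplit
  generalize (f.roots.filter (¬ · = r)).card = l at hsplit
  have hkl : k = l := by
    rw [hsplit] at hsum
    simp only [Multiset.sum_add, Multiset.sum_replicate, nsmul_eq_mul] at hsum
    have : (k : ℂ) = l := mul_right_cancel₀ hr (by linear_combination hsum)
    exact_mod_cast this
  have hkn : k = n := by
    rw [hsplit] at hcard
    simp at hcard
    omega
  subst hkl hkn
  rw [hs.eq_prod_roots_of_monic hf, hsplit]
  simp only [Multiset.map_add, Multiset.map_replicate, Multiset.prod_add, Multiset.prod_replicate]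
  rw [← mul_pow]
  congr 1
  simp only [map_neg, map_pow]
  ring

/-! ### Determination of the weight enumerator -/

namespace LinearCodes

section

variable {F : Type*} [Field F] [Fintype F] [DecidableEq F] {N : ℕ}

/-- Zeros of the weight enumerator of a divisible formally self-dual code are eigenvectors of the
product of the MacWilliams transformation and `diag(1, ζ)`. -/
theorem root_weightPolynomial_eigenvector (hq : 4 < Fintype.card F) {C : Code F N}
    (hC : IsFormallySelfDual C) {m : ℕ} (hm : 0 < m) (hd : IsDivisibleBy C m) {ζ : ℂ}
    (hζ : ζ ^ m = 1) (hζ1 : ζ ≠ 1) {x : ℂ} (hx : (weightPolynomial C).IsRoot x) :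
    x + (Fintype.card F - 1) * ζ = x * (x - ζ) := by
  have hζ0 : ζ ≠ 0 := by rintro rfl; simp [hm.ne'] at hζ
  have hq0 : (Fintype.card F : ℂ) ≠ 0 := by exact_mod_cast (by omega : Fintype.card F ≠ 0)
  let p : ℕ → ℂ × ℂ := fun k =>
    (fun v : ℂ × ℂ => (v.1 + (Fintype.card F - 1) * ζ * v.2, v.1 - ζ * v.2))^[k] (x, 1)
  have hp : ∀ k, p (k + 1) =
      ((p k).1 + (Fintype.card F - 1) * ζ * (p k).2, (p k).1 - ζ * (p k).2) := fun k =>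
    Function.iterate_succ_apply' _ _ _
  have hzero : ∀ k, weightFunction C (p k).1 (p k).2 = 0 := by
    intro k
    induction k with
    | zero => rw [← hx.eq_zero, eval_weightPolynomial]; rfl
    | succ k ih =>
      rw [hp]
      exact weightFunction_eq_zero_of_macWilliams hC hd hζ ih
  -- The map is invertible (determinant `-q ζ`), so the orbit avoids the zero vector.
  have hpair : ∀ k, (p k).2 = 0 → (p k).1 ≠ 0 := by
    intro k
    induction k with
    | zero => exact fun h => absurd h one_ne_zero
    | succ k ih =>
      rw [hp]
      intro h2 h1
      have h3 : (p k).2 = 0 := (mul_eq_zero.1 (show Fintype.card F * ζ * (p k).2 = 0 by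
        linear_combination h1 - h2)).resolve_left (mul_ne_zero hq0 hζ0)
      exact ih h3 (by linear_combination h2 + ζ * h3)
  -- On `y = 0` the enumerator is `x ^ N`, so there is no zero at infinity.
  have hne : ∀ k, (p k).2 ≠ 0 := by
    intro k h
    have h0 := hzero k
    rw [h, weightFunction_zero_right] at h0
    exact hpair k h (eq_zero_of_pow_eq_zero h0)
  have hroot : ∀ k, (p k).1 / (p k).2 ∈ (weightPolynomial C).roots.toFinset := fun k => by
    rw [Multiset.mem_toFinset, mem_roots (weightPolynomial_monic C).ne_zero,
      ← weightFunction_eq_zero_iff C (hne k)]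
    exact hzero k
  obtain ⟨i, j, hij, hpar⟩ : ∃ i j, i < j ∧ (p i).1 / (p i).2 = (p j).1 / (p j).2 := by
    obtain ⟨i, j, hij, h⟩ := Finite.exists_ne_map_eq_of_infinite
      (fun k => (⟨_, hroot k⟩ : (weightPolynomial C).roots.toFinset))
    have h := congrArg Subtype.val h
    rcases lt_or_gt_of_ne hij with h' | h'
    · exact ⟨i, j, h', h⟩
    · exact ⟨j, i, h', h.symm⟩
  rw [div_eq_div_iff (hne i) (hne j)] at hpar
  have := isEigenvector_of_iterate_parallel hq hm hζ hζ1 (fun k => (p k).1) (fun k => (p k).2)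
    (fun k => by rw [hp]) (fun k => by rw [hp]) hij hpar
  simpa [p] using this

theorem root_weightPolynomial (hq : 4 < Fintype.card F) {C : Code F N}
    (hC : IsFormallySelfDual C) {m : ℕ} (hm : 1 < m) (hd : IsDivisibleBy C m) {x : ℂ}
    (hx : (weightPolynomial C).IsRoot x) :
    m = 2 ∧ x ^ 2 = -(Fintype.card F - 1) := by
  have hprim := Complex.isPrimitiveRoot_exp m (by omega)
  set ζ : ℂ := Complex.exp (2 * Real.pi * Complex.I / m)
  have hζ0 : ζ ≠ 0 := Complex.exp_ne_zero _
  have hζ1 : ζ ≠ 1 := hprim.ne_one hm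
  have hq0 : (Fintype.card F : ℂ) ≠ 0 := by exact_mod_cast (by omega : Fintype.card F ≠ 0)
  have hq1 : (Fintype.card F : ℂ) - 1 ≠ 0 :=
    sub_ne_zero.2 (by exact_mod_cast (by omega : Fintype.card F ≠ 1))
  have h1 := root_weightPolynomial_eigenvector hq hC (by omega) hd hprim.pow_eq_one hζ1 hx
  have h2 := root_weightPolynomial_eigenvector hq hC (by omega) hd
    (ζ := ζ⁻¹) (by rw [inv_pow, hprim.pow_eq_one, inv_one]) (by simpa using hζ1) hx
  have h3 : (ζ - ζ⁻¹) * (Fintype.card F - 1 + x) = 0 := by linear_combination h1 - h2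
  have hsq : ζ ^ 2 = 1 := by
    rcases mul_eq_zero.1 h3 with h | h
    · field_simp at h
      linear_combination h
    · have hx' : x = -(Fintype.card F - 1) := by linear_combination h
      rw [hx'] at h1
      exact absurd (show (Fintype.card F : ℂ) * (Fintype.card F - 1) = 0 by
        linear_combination -h1) (mul_ne_zero hq0 hq1)
  have hm2 : m = 2 := by
    have := Nat.le_of_dvd two_pos ((hprim.pow_eq_one_iff_dvd 2).1 hsq)
    omega
  refine ⟨hm2, ?_⟩
  have hζ : ζ = -1 :=
    ((sq_eq_sq_iff_eq_or_eq_neg (b := (1 : ℂ))).1 (by rw [hsq, one_pow])).resolve_left hζ1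
  rw [hζ] at h1
  linear_combination -h1

theorem weightPolynomial_eq (hq : 4 < Fintype.card F) {n : ℕ} (hn : 0 < n) {C : Code F (2 * n)}
    (hC : IsFormallySelfDual C) (hd : IsDivisible C) :
    IsDivisibleBy C 2 ∧
      weightPolynomial C = (Polynomial.X ^ 2 - Polynomial.C (-(Fintype.card F - 1 : ℂ))) ^ n := by
  obtain ⟨m, hm, hd⟩ := hd
  -- One root is needed to learn that `m = 2`; it exists because `n > 0`.
  obtain ⟨x, hx⟩ := IsAlgClosed.exists_root (weightPolynomial C)
    (by rw [degree_eq_natDegree (weightPolynomial_monic C).ne_zero, natDegree_weightPolynomial]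
        exact_mod_cast (by omega : 2 * n ≠ 0))
  obtain ⟨rfl, -⟩ := root_weightPolynomial hq hC hm hd hx
  refine ⟨hd, eq_X_sq_sub_C_pow_of_roots (weightPolynomial_monic C) hn
    (natDegree_weightPolynomial C) ?_ ?_ fun x hx => (root_weightPolynomial hq hC hm hd hx).2⟩
  -- The next-to-leading coefficient counts words of weight one, which evenness excludes.
  · classical
    rw [weightPolynomial_coeff C 1 (by omega), Nat.cast_eq_zero, Finset.card_eq_zero,
      Finset.filter_eq_empty_iff]
    rintro c - ⟨hc, hw⟩
    have := hd c hc
    omega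
  · exact neg_ne_zero.2 (sub_ne_zero.2 (by exact_mod_cast (by omega : Fintype.card F ≠ 1)))

open Classical in
-- Evaluation of the weight polynomial at `1`.
theorem card_code_eq (hq : 4 < Fintype.card F) {n : ℕ} (hn : 0 < n) {C : Code F (2 * n)}
    (hC : IsFormallySelfDual C) (hd : IsDivisible C) :
    (Finset.univ.filter fun c : Fin (2 * n) → F => c ∈ C).card = Fintype.card F ^ n := by
  have h := eval_weightPolynomial C 1
  rw [(weightPolynomial_eq hq hn hC hd).2, weightFunction] at h
  simp only [Polynomial.eval_pow, Polynomial.eval_sub, Polynomial.eval_X,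
    Polynomial.eval_C, one_pow, mul_one, Finset.sum_const, nsmul_eq_mul] at h
  have h' : ((Fintype.card F : ℂ)) ^ n =
      (Finset.univ.filter fun c : Fin (2 * n) → F => c ∈ C).card := by
    rw [← h]; ring
  exact_mod_cast h'.symm

open Classical in
theorem card_weight_two_eq (hq : 4 < Fintype.card F) {n : ℕ} (hn : 0 < n) {C : Code F (2 * n)}
    (hC : IsFormallySelfDual C) (hd : IsDivisible C) :
    (Finset.univ.filter fun c : Fin (2 * n) → F => c ∈ C ∧ hammingNorm c = 2).card =
      n * (Fintype.card F - 1) := by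
  have h := weightPolynomial_coeff C 2 (by omega)
  have hexp : (Polynomial.X ^ 2 - Polynomial.C (-(Fintype.card F - 1 : ℂ))) ^ n =
      Polynomial.expand ℂ 2 ((Polynomial.X + Polynomial.C (Fintype.card F - 1 : ℂ)) ^ n) := by
    rw [map_neg, sub_neg_eq_add, map_pow, map_add, Polynomial.expand_X, Polynomial.expand_C]
  rw [(weightPolynomial_eq hq hn hC hd).2, hexp, show 2 * n - 2 = (n - 1) * 2 by omega,
    coeff_expand_mul two_pos, Polynomial.coeff_X_add_C_pow, show n - (n - 1) = 1 by omega, pow_one,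
    Nat.choose_symm_of_eq_add (show n = (n - 1) + 1 by omega), Nat.choose_one_right] at h
  zify [show 1 ≤ Fintype.card F by omega]
  have : (((Finset.univ.filter fun c : Fin (2 * n) → F => c ∈ C ∧ hammingNorm c = 2).card : ℤ) : ℂ)
      = ((n * (Fintype.card F - 1) : ℤ) : ℂ) := by
    push_cast
    rw [← h]; ring
  exact_mod_cast this

end

end LinearCodes

end

/-! ### Pairings and words of weight two -/

/-- Two fixed-point-free involutions of a finite type are conjugate. -/
theorem Equiv.Perm.isConj_of_involutive_of_fixedPointFree {α : Type*} [Fintype α] [DecidableEq α]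
    {σ τ : Equiv.Perm α} (hσ : σ ^ 2 = 1) (hτ : τ ^ 2 = 1) (hσ' : ∀ x, σ x ≠ x)
    (hτ' : ∀ x, τ x ≠ x) : IsConj σ τ := by
  have key : ∀ ρ : Equiv.Perm α, ρ ^ 2 = 1 → (∀ x, ρ x ≠ x) →
      ρ.cycleType = Multiset.replicate (Fintype.card α / 2) 2 := by
    intro ρ h h'
    have h1 := Equiv.Perm.cycleType_of_pow_prime_eq_one (p := 2) h
    have h2 := ρ.sum_cycleType
    have h3 : ρ.support = Finset.univ := Finset.eq_univ_of_forall fun x => by simpa using h' x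
    rw [h3, Finset.card_univ, h1, Multiset.sum_replicate, smul_eq_mul] at h2
    rw [h1, ← h2, Nat.mul_div_cancel _ two_pos]
  rw [Equiv.Perm.isConj_iff_cycleType_eq, key σ hσ hσ', key τ hτ hτ']

namespace LinearCodes

theorem exists_support_of_weight_two {F : Type*} [Field F] [DecidableEq F] {N : ℕ}
    {c : Fin N → F} (hc : hammingNorm c = 2) {i : Fin N}
    (hi : c i ≠ 0) : ∃ j, i ≠ j ∧ c j ≠ 0 ∧ ∀ k, k ≠ i → k ≠ j → c k = 0 := by
  obtain ⟨a, b, hab, h⟩ := Finset.card_eq_two.1 hc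
  have h' : ∀ k, c k ≠ 0 ↔ k = a ∨ k = b := fun k => by
    simpa using Finset.ext_iff.1 h k
  rcases (h' i).1 hi with rfl | rfl
  · exact ⟨b, hab, (h' b).2 (Or.inr rfl), fun k h1 h2 => by
      by_contra h3; exact ((h' k).1 h3).elim h1 h2⟩
  · exact ⟨a, hab.symm, (h' a).2 (Or.inl rfl), fun k h1 h2 => by
      by_contra h3; exact ((h' k).1 h3).elim h2 h1⟩

section

variable {F : Type*} [Field F] [Fintype F] [DecidableEq F] {N : ℕ}

/-- In an even code over a field with more than two elements, the coordinates of a codeword at the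
support of a weight-two codeword are proportional to it. -/
theorem apply_eq_mul_of_even (hq : 2 < Fintype.card F) {C : Code F N} (hC : IsDivisibleBy C 2)
    {c v : Fin N → F} (hc : c ∈ C) (hv : v ∈ C) {i j : Fin N} (hij : i ≠ j) (hci : c i = 1)
    (hcj : c j ≠ 0) (hsupp : ∀ k, k ≠ i → k ≠ j → c k = 0) : v j = c j * v i := by
  by_contra hne
  set w := v - v i • c with hw
  have hwC : w ∈ C := C.sub_mem hv (C.smul_mem _ hc)
  have hwi : w i = 0 := by simp [hw, hci]
  have hwj : w j ≠ 0 := by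
    simp only [hw, Pi.sub_apply, Pi.smul_apply, smul_eq_mul]
    exact fun h => hne (by linear_combination h)
  -- Adding `μ • c` then makes coordinate `i` non-zero and keeps coordinate `j` non-zero, so the
  -- weight grows by exactly one, against evenness.
  obtain ⟨μ, hμ⟩ : ∃ μ : F, μ ∉ ({0, -(w j) / c j} : Finset F) := by
    by_contra! h
    have h1 : (Finset.univ : Finset F).card ≤ ({0, -(w j) / c j} : Finset F).card :=
      Finset.card_le_card fun x _ => h x
    have := Finset.card_le_two (a := (0 : F)) (b := -(w j) / c j)
    rw [Finset.card_univ] at h1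
    omega
  simp only [Finset.mem_insert, Finset.mem_singleton, not_or] at hμ
  have hμC : w + μ • c ∈ C := C.add_mem hwC (C.smul_mem _ hc)
  have hsum : hammingNorm (w + μ • c) = hammingNorm w + 1 := by
    rw [hammingNorm, hammingNorm, ← Finset.card_insert_of_notMem (a := i) (by simp [hwi])]
    congr 1
    ext k
    simp only [Finset.mem_filter, Finset.mem_univ, true_and, Finset.mem_insert, Pi.add_apply,
      Pi.smul_apply, smul_eq_mul]
    by_cases hki : k = i
    · subst hki
      simp [hwi, hci, hμ.1]
    by_cases hkj : k = j
    · subst hkj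
      simp only [ne_eq, hwj, not_false_eq_true, or_true, iff_true]
      intro h
      exact hμ.2 (by field_simp; linear_combination h)
    · simp [hsupp k hki hkj, hki]
  have h1 := hC _ hwC
  have h2 := hC _ hμC
  omega

open Classical in
-- A word of weight two through `i` is determined by its value there: proportionality fixes the
-- other support position and its value.
theorem card_weight_two_at_le (hq : 2 < Fintype.card F) {C : Code F N} (hC : IsDivisibleBy C 2)
    (i : Fin N) :
    (Finset.univ.filter fun c : Fin N → F => (c ∈ C ∧ hammingNorm c = 2) ∧ c i ≠ 0).card ≤
      Fintype.card F - 1 := by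
  have himg : Fintype.card F - 1 = (Finset.univ.erase (0 : F)).card := by
    rw [Finset.card_erase_of_mem (Finset.mem_univ _), Finset.card_univ]
  rw [himg]
  refine Finset.card_le_card_of_injOn (fun c => c i) (fun c hc => by simpa using
    (Finset.mem_filter.1 hc).2.2) ?_
  intro c hc d hd hcd
  simp only [Finset.coe_filter, Finset.mem_univ, true_and, Set.mem_ofPred_eq] at hc hd hcd
  obtain ⟨⟨hcC, hc2⟩, hci⟩ := hc
  obtain ⟨⟨hdC, hd2⟩, hdi⟩ := hd
  obtain ⟨j, hij, hcj, hs⟩ := exists_support_of_weight_two hc2 hci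
  have h := apply_eq_mul_of_even hq hC (c := (c i)⁻¹ • c) (C.smul_mem _ hcC) hdC hij (by simp [hci])
    (by simp [hci, hcj]) (fun k h1 h2 => by simp [hs k h1 h2])
  have hdj : d j = c j := by
    rw [h, ← hcd]
    simp only [Pi.smul_apply, smul_eq_mul]
    field_simp
  obtain ⟨j', hij', hdj', hs'⟩ := exists_support_of_weight_two hd2 hdi
  have hjj' : j = j' := by
    by_contra hne
    exact hcj (hdj ▸ hs' j hij.symm hne)
  subst hjj'
  ext k
  by_cases h1 : k = i
  · rw [h1, hcd]
  by_cases h2 : k = j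
  · rw [h2, hdj]
  rw [hs k h1 h2, hs' k h1 h2]

open Classical in
-- The words have `2n (q - 1)` incidences with `2n` positions, each lying on at most `q - 1`, so no
-- position can be missed.
theorem exists_weight_two_at (hq : 2 < Fintype.card F) {n : ℕ} {C : Code F (2 * n)}
    (hC : IsDivisibleBy C 2)
    (hcard : (Finset.univ.filter fun c : Fin (2 * n) → F => c ∈ C ∧ hammingNorm c = 2).card =
      n * (Fintype.card F - 1)) (i : Fin (2 * n)) :
    ∃ c ∈ C, hammingNorm c = 2 ∧ c i ≠ 0 := by
  by_contra! hno
  set S := Finset.univ.filter fun c : Fin (2 * n) → F => c ∈ C ∧ hammingNorm c = 2 with hS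
  have hdouble : ∑ k : Fin (2 * n), (S.filter fun c => c k ≠ 0).card = S.card * 2 := by
    have h := Finset.sum_card_bipartiteAbove_eq_sum_card_bipartiteBelow (s := S)
      (t := (Finset.univ : Finset (Fin (2 * n)))) (fun c k => c k ≠ 0)
    simp only [Finset.bipartiteAbove, Finset.bipartiteBelow] at h
    rw [← h, Finset.sum_const_nat (m := 2)]
    intro c hc
    exact (Finset.mem_filter.1 hc).2.2
  have hlt : ∑ k : Fin (2 * n), (S.filter fun c => c k ≠ 0).card <
      ∑ k : Fin (2 * n), (Fintype.card F - 1) := by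
    refine Finset.sum_lt_sum (fun k _ => ?_) ⟨i, Finset.mem_univ _, ?_⟩
    · rw [hS, Finset.filter_filter]
      exact card_weight_two_at_le hq hC k
    · have : (S.filter fun c => c i ≠ 0) = ∅ := by
        rw [Finset.filter_eq_empty_iff]
        intro c hc
        have := (Finset.mem_filter.1 hc).2
        simpa using hno c this.1 this.2
      rw [this, Finset.card_empty]
      omega
  rw [hdouble, hcard, Finset.sum_const, Finset.card_univ, Fintype.card_fin, smul_eq_mul] at hlt
  exact absurd hlt (by rw [not_lt]; exact le_of_eq (by ring))

end

/-! ### Monomial equivalence with the sum of repetition codes -/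

theorem monomialMap_apply {F : Type*} [Field F] {N : ℕ} (d : Fin N → Fˣ)
    (σ : Equiv.Perm (Fin N)) (v : Fin N → F) (i : Fin N) :
    monomialMap d σ v i = d i * v (σ i) := by
  rw [monomialMap, Matrix.mulVecLin_apply, ← Matrix.mulVec_mulVec, Matrix.mulVec_diagonal,
    Matrix.permMatrix_mulVec]
  rfl

theorem monomialMap_injective {F : Type*} [Field F] {N : ℕ} (d : Fin N → Fˣ)
    (σ : Equiv.Perm (Fin N)) : Function.Injective (monomialMap d σ) := by
  intro v w h
  ext i
  have := congrFun h (σ.symm i)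
  simpa [monomialMap_apply] using this

theorem mem_directSumCopies_repetitionTwo {F : Type*} [Field F] {n : ℕ} {v : Fin (2 * n) → F} :
    v ∈ directSumCopies (repetitionTwo F) n ↔ ∀ i, v (block 2 n i 0) = v (block 2 n i 1) := by
  simp only [directSumCopies, Submodule.mem_iInf, Submodule.mem_comap, repetitionTwo,
    Submodule.mem_span_singleton]
  refine forall_congr' fun i => ⟨?_, fun h => ⟨v (block 2 n i 0), ?_⟩⟩
  · rintro ⟨a, ha⟩
    have h0 := congrFun ha 0
    have h1 := congrFun ha 1
    simp [LinearMap.funLeft_apply] at h0 h1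
    rw [← h0, ← h1]
  · ext k
    fin_cases k
    · simp [LinearMap.funLeft_apply]
    · simp [LinearMap.funLeft_apply, h]

theorem finrank_directSumCopies_repetitionTwo_le (F : Type*) [Field F] (n : ℕ) :
    Module.finrank F (directSumCopies (repetitionTwo F) n) ≤ n := by
  let f : directSumCopies (repetitionTwo F) n →ₗ[F] (Fin n → F) :=
    LinearMap.funLeft F F (fun i => block 2 n i 0) ∘ₗ Submodule.subtype _
  have hf : Function.Injective f := by
    rintro ⟨v, hv⟩ ⟨w, hw⟩ h
    rw [mem_directSumCopies_repetitionTwo] at hv hw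
    have h0 : ∀ i, v (block 2 n i 0) = w (block 2 n i 0) := fun i => congrFun h i
    refine Subtype.ext (funext fun k => ?_)
    rcases Nat.even_or_odd' (k : ℕ) with ⟨l, hl | hl⟩
    · have : k = block 2 n ⟨l, by omega⟩ 0 := Fin.ext hl
      rw [this]
      exact h0 _
    · have : k = block 2 n ⟨l, by omega⟩ 1 := Fin.ext hl
      rw [this]
      exact (hv _).symm.trans ((h0 _).trans (hw _))
  simpa using LinearMap.finrank_le_finrank_of_injective hf

/-- The involution of `Fin (2 * n)` exchanging the two positions of each block of length two. -/
def blockSwap (n : ℕ) (k : Fin (2 * n)) : Fin (2 * n) :=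
  if h : (k : ℕ) % 2 = 0 then ⟨k + 1, by omega⟩ else ⟨k - 1, by omega⟩

theorem val_blockSwap (n : ℕ) (k : Fin (2 * n)) :
    (blockSwap n k : ℕ) = if (k : ℕ) % 2 = 0 then (k : ℕ) + 1 else k - 1 := by
  unfold blockSwap
  split_ifs <;> rfl

theorem blockSwap_involutive (n : ℕ) : Function.Involutive (blockSwap n) := by
  intro k
  ext
  simp only [val_blockSwap]
  split_ifs <;> omega

theorem blockSwap_ne (n : ℕ) (k : Fin (2 * n)) : blockSwap n k ≠ k := by
  intro h
  have := congrArg Fin.val h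
  rw [val_blockSwap] at this
  split_ifs at this <;> omega

theorem blockSwap_block (n : ℕ) (i : Fin n) : blockSwap n (block 2 n i 0) = block 2 n i 1 := by
  ext
  simp [blockSwap, block]

/-- A code of dimension at least `n` on `2n` positions that are paired by proportionality is
equivalent to a sum of copies of the repetition code of length two. -/
theorem isEquivalent_directSumCopies_of_pairing {F : Type*} [Field F] {n : ℕ} {C : Code F (2 * n)}
    (hn : n ≤ Module.finrank F C) {τ : Fin (2 * n) → Fin (2 * n)} (hτ : Function.Involutive τ)
    (hτ' : ∀ i, τ i ≠ i) (s : Fin (2 * n) → Fˣ) (hs : ∀ v ∈ C, ∀ i, v (τ i) = s i * v i) :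
    IsEquivalent C (directSumCopies (repetitionTwo F) n) := by
  obtain ⟨g, hg⟩ := isConj_iff.1 (Equiv.Perm.isConj_of_involutive_of_fixedPointFree
    (σ := (blockSwap_involutive n).toPerm) (τ := hτ.toPerm)
    (Equiv.ext fun k => by simp [sq, blockSwap_involutive n k]) (Equiv.ext fun k => by simp [sq, hτ k])
    (blockSwap_ne n) hτ')
  have hg' : ∀ k, τ (g k) = g (blockSwap n k) := fun k => by
    have := congrArg (fun e : Equiv.Perm (Fin (2 * n)) => e (g k)) hg
    simpa using this.symm
  -- After `g` carries `blockSwap` to `τ`, scaling the first entry of each block by its ratio makes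
  -- the two entries equal.
  let d : Fin (2 * n) → Fˣ := fun k => if (k : ℕ) % 2 = 0 then s (g k) else 1
  refine ⟨d, g, (Submodule.eq_of_le_of_finrank_le ?_ ?_).symm⟩
  · rintro _ ⟨v, hv, rfl⟩
    rw [mem_directSumCopies_repetitionTwo]
    intro i
    rw [monomialMap_apply, monomialMap_apply, ← blockSwap_block, ← hg', hs v hv, blockSwap_block]
    simp [d, block]
  · rw [← (Submodule.equivMapOfInjective _ (monomialMap_injective d g) C).finrank_eq]
    exact (finrank_directSumCopies_repetitionTwo_le F n).trans hn

end LinearCodes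

theorem mainTheorem4 {F : Type*} [Field F] [Fintype F] [DecidableEq F]
    (hq : 4 < Fintype.card F) (n : ℕ) (C : LinearCodes.Code F (2 * n))
    (hfsd : LinearCodes.IsFormallySelfDual C) (hdiv : LinearCodes.IsDivisible C) :
    LinearCodes.IsEquivalent C
      (LinearCodes.directSumCopies (LinearCodes.repetitionTwo F) n) := by
  classical
  rcases Nat.eq_zero_or_pos n with rfl | hn
  · refine LinearCodes.isEquivalent_directSumCopies_of_pairing (Nat.zero_le _) (τ := id)
      (fun _ => rfl) (fun i => i.elim0) (fun _ => 1) fun _ _ i => i.elim0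
  have heven := (LinearCodes.weightPolynomial_eq hq hn hfsd hdiv).1
  have hdim : Module.finrank F C = n := by
    have h1 := LinearCodes.card_code_eq hq hn hfsd hdiv
    have h2 := Module.card_eq_pow_finrank (K := F) (V := C)
    rw [← Fintype.card_subtype] at h1
    exact Nat.pow_right_injective (by omega : 2 ≤ Fintype.card F) (h2.symm.trans h1)
  have hword : ∀ i, ∃ c ∈ C, ∃ j, c i = 1 ∧ i ≠ j ∧ c j ≠ 0 ∧ ∀ k, k ≠ i → k ≠ j → c k = 0 := by
    intro i
    obtain ⟨c, hc, h2, hi⟩ := LinearCodes.exists_weight_two_at (by omega) heven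
      (LinearCodes.card_weight_two_eq hq hn hfsd hdiv) i
    obtain ⟨j, hij, hj, hk⟩ := LinearCodes.exists_support_of_weight_two h2 hi
    exact ⟨(c i)⁻¹ • c, C.smul_mem _ hc, j, by simp [hi], hij, by simp [hi, hj],
      fun k h1 h2 => by simp [hk k h1 h2]⟩
  choose c hc τ hci hne hcj hsupp using hword
  have hprop : ∀ v ∈ C, ∀ i, v (τ i) = c i (τ i) * v i := fun v hv i =>
    LinearCodes.apply_eq_mul_of_even (by omega) heven (hc i) hv (hne i) (hci i) (hcj i) (hsupp i)
  refine LinearCodes.isEquivalent_directSumCopies_of_pairing hdim.ge (τ := τ) (fun i => ?_)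
    (fun i => (hne i).symm) (fun i => Units.mk0 _ (hcj i)) hprop
  -- If `τ (τ i) ≠ i`, then `c i` vanishes at `τ (τ i)`, yet proportionality along `c (τ i)` makes
  -- that entry a non-zero multiple of `c i (τ i)`.
  by_contra h
  have h1 := hprop (c i) (hc i) (τ i)
  rw [hsupp i _ h (hne (τ i)).symm] at h1
  exact mul_ne_zero (hcj (τ i)) (hcj i) h1.symm
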